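/- Let $(W,(s_i)_{i\in I})$ be a finite Coxeter group with length function $\ell$ and longest element $w_0$. Let $u\le_L v$ (left order), respectively $u\le_{LR}v$ (left-right order), mean that some reduced word of $u$ is a right factor, respectively a factor (a block of consecutive letters), of some reduced word of $v$, and let $[a,b]_L=\{u\in W : a\le_L u\le_L b\}$. For $i\in I$ define maps $\pi_i,\overline{\pi}_i:W\to W$, acting on the right, by $$w.\pi_i=\begin{cases} w & \text{if } \ell(ws_i)<\ell(w),\\ ws_i & \text{otherwise,}\end{cases}\qquad w.\overline{\pi}_i=\begin{cases} ws_i & \text{if } \ell(ws_i)<\ell(w),\\ w & \text{otherwise.}\end{cases}$$ Let the biHecke monoid $M=M(W)$ be the monoid of maps $W\to W$ generated by all $\pi_i$ and $\overline{\pi}_i$, where $fg$ means first $f$, then $g$. For $w\in W$ put $\pi_w=\pi_{i_1}\cdots\pi_{i_k}$ and $\overline{\pi}_w=\overline{\pi}_{i_1}\cdots\overline{\pi}_{i_k}$ for any reduced word $i_1\cdots i_k$ of $w$ (these do not depend on the reduced word), and $$e_w=\pi_{w^{-1}w_0}\,\overline{\pi}_{w_0w}\in M.$$ Two idempotents $e,f\in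 M$ are called conjugate if $e=xy$ and $f=yx$ for some $x,y\in M$. For idempotents of $M$ this is the same as $J$-equivalence, $MeM=MfM$. Then the idempotents $(e_w)_{w\in W}$ form a complete set of representatives of the conjugacy classes of idempotents of $M$: each $e_w$ is an idempotent, and each idempotent of $M$ is conjugate to $e_w$ for exactly one $w\in W$. Moreover, the image set of each idempotent of $M$ is an interval $[a,b]_L$ with $a\le_L b$, and if $e$ and $f$ are idempotents of $M$ with image sets $[a,b]_L$ and $[c,d]_L$ respectively, then $f\in MeM$ if and only if $dc^{-1}\le_{LR}ba^{-1}$; and $e$ and $f$ are conjugate if and only if the two intervals have the same type, that is, $dc^{-1}=ba^{-1}$. -/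

import Mathlib

namespace CoxeterSystem

section Monoid

/-- The two-sided principal ideal `M e M` of an element `e` of a monoid `M`. -/
def twoSidedIdeal {M : Type*} [Monoid M] (e : M) : Set M :=
  {g | ∃ x y : M, g = x * e * y}

/-- Two elements are `J`-equivalent if they generate the same two-sided principal ideal. -/
def JEquiv {M : Type*} [Monoid M] (e f : M) : Prop :=
  twoSidedIdeal e = twoSidedIdeal f

/-- Conjugacy of idempotents of a monoid: `e = x y` and `f = y x` for some `x, y` in the monoid. -/
def ConjugateIdem {M : Type*} [Monoid M] (e f : M) : Prop :=
  ∃ x y : M, e = x * y ∧ f = y * x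

end Monoid

section Coxeter

variable {B W : Type*} [Group W] {C : CoxeterMatrix B} (cs : CoxeterSystem C W)

/-- Left weak order: some reduced word of `u` is a right factor of some reduced word of `v`. -/
def LeftLE (u v : W) : Prop :=
  ∃ ω ω' : List B, cs.IsReduced ω ∧ cs.wordProd ω = u ∧ cs.IsReduced ω' ∧ cs.wordProd ω' = v ∧
    ω <:+ ω'

/-- Left-right weak order: some reduced word of `u` is a factor (a block of consecutive letters)
of some reduced word of `v`. -/
def LeftRightLE (u v : W) : Prop :=
  ∃ ω ω' : List B, cs.IsReduced ω ∧ cs.wordProd ω = u ∧ cs.IsReduced ω' ∧ cs.wordProd ω' = v ∧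
    ω <:+: ω'

/-- The interval `[a, b]_L` of left weak order. -/
def leftInterval (a b : W) : Set W :=
  {u | cs.LeftLE a u ∧ cs.LeftLE u b}

/-- A longest element `w₀` of a finite Coxeter group. -/
noncomputable def longest [Finite W] : W :=
  (Finite.exists_max cs.length).choose

theorem length_le_length_longest [Finite W] (u : W) : cs.length u ≤ cs.length cs.longest :=
  (Finite.exists_max cs.length).choose_spec u

open Classical in
/-- The elementary antisorting map `w ↦ w.π_i`: it fixes `w` if `i` is a right descent of `w`,
and sends `w` to `w s_i` otherwise. -/
noncomputable def antisortFun (i : B) : W → W :=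
  fun w => if cs.IsRightDescent w i then w else w * cs.simple i

open Classical in
/-- The elementary sorting map: it sends `w` to `w s_i` if `i` is a right descent of `w`,
and fixes `w` otherwise. -/
noncomputable def sortFun (i : B) : W → W :=
  fun w => if cs.IsRightDescent w i then w * cs.simple i else w

/-- The biHecke monoid: the monoid of maps `W → W` generated by all elementary sorting and
antisorting maps. Maps act on the right, so that `f * g` is "first `f`, then `g`"; this is the
multiplication of the opposite of the monoid `Function.End W`. -/
noncomputable def biHecke : Submonoid (Function.End W)ᵐᵒᵖ :=
  Submonoid.closure
    (Set.range (fun i => MulOpposite.op (cs.antisortFun i : Function.End W)) ∪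
      Set.range (fun i => MulOpposite.op (cs.sortFun i : Function.End W)))

/-- The right action `u.f` of an element `f` of the biHecke monoid on `u`. -/
def act (u : W) (f : cs.biHecke) : W :=
  (MulOpposite.unop (f : (Function.End W)ᵐᵒᵖ) : W → W) u

/-- The image set of an element of the biHecke monoid. -/
def imageSet (f : cs.biHecke) : Set W :=
  Set.range (fun u => cs.act u f)

/-- The right action is compatible with the multiplication. -/
theorem act_mul (u : W) (f g : cs.biHecke) : cs.act u (f * g) = cs.act (cs.act u f) g := rfl

/-- The generator `π_i` of the biHecke monoid. -/
noncomputable def antisortGen (i : B) : cs.biHecke :=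
  ⟨MulOpposite.op (cs.antisortFun i : Function.End W),
    Submonoid.subset_closure (Or.inl ⟨i, rfl⟩)⟩

/-- The generator `π̄_i` of the biHecke monoid. -/
noncomputable def sortGen (i : B) : cs.biHecke :=
  ⟨MulOpposite.op (cs.sortFun i : Function.End W),
    Submonoid.subset_closure (Or.inr ⟨i, rfl⟩)⟩

/-- The product `π_{i₁} ⋯ π_{iₖ}` for a word `i₁ … iₖ`. -/
noncomputable def antisortWord (ω : List B) : cs.biHecke :=
  (ω.map cs.antisortGen).prod

/-- The product `π̄_{i₁} ⋯ π̄_{iₖ}` for a word `i₁ … iₖ`. -/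
noncomputable def sortWord (ω : List B) : cs.biHecke :=
  (ω.map cs.sortGen).prod

/-- A reduced word of `w`. -/
noncomputable def reducedWord (w : W) : List B :=
  (cs.exists_isReduced w).choose

theorem reducedWord_spec (w : W) :
    cs.IsReduced (cs.reducedWord w) ∧ w = cs.wordProd (cs.reducedWord w) :=
  (cs.exists_isReduced w).choose_spec

/-- `π_w`, the product of the `π_i` along a reduced word of `w`. -/
noncomputable def antisort (w : W) : cs.biHecke :=
  cs.antisortWord (cs.reducedWord w)

/-- `π̄_w`, the product of the `π̄_i` along a reduced word of `w`. -/
noncomputable def sort (w : W) : cs.biHecke :=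
  cs.sortWord (cs.reducedWord w)

/-- `e_w = π_{w⁻¹ w₀} π̄_{w₀ w}`. -/
noncomputable def idem [Finite W] (w : W) : cs.biHecke :=
  cs.antisort (w⁻¹ * cs.longest) * cs.sort (cs.longest * w)

end Coxeter

end CoxeterSystem

/-! Everything rests on one property of `M`: on a cover `u < s_j u` of left order, an element of `M`
either identifies the two points or maps them to a cover with the same label `s_j`
(`act_simple_mul`, from an exchange property). Hence elements of `M` preserve left order and never
increase length differences; where the difference across `[a, b]_L` is kept, the whole interval is
right translated (`act_eq_of_mem_leftInterval`).

An idempotent fixes the images of `1` and `w₀`, hence the interval between them, which is therefore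
its image. Conversely, intervals of equal type are translated onto each other by elements of `M`
(`act_sort_inv_mul_antisort`), which gives conjugacy. If `f = x e y`, then `[c, d]_L` passes through
`[a, b]_L` without shrinking, so its type is a factor of `b a⁻¹`; a length-additive factorization of
`b a⁻¹` conversely lets `f` factor through `e`. Antisymmetry of left-right order turns
`J`-equivalence into equality of types, and `e_w` has image `[1, w]_L`, of type `w`. -/

namespace CoxeterSystem

/-! ### Exchange property from an action on signed group elements. -/

section Exchange

variable {B W : Type*} [Group W] {C : CoxeterMatrix B} (cs : CoxeterSystem C W)

open Classical in
/-- The action of a simple reflection on pairs of a group element and a sign: conjugation on the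
first component, and a change of sign exactly at the simple reflection itself. -/
noncomputable def signedConj (i : B) : Function.End (W × ZMod 2) :=
  fun p => (cs.simple i * p.1 * cs.simple i, p.2 + if p.1 = cs.simple i then 1 else 0)

theorem simple_mul_pow (i j : B) (n : ℕ) :
    cs.simple j * (cs.simple i * cs.simple j) ^ n =
      ((cs.simple i * cs.simple j) ^ n)⁻¹ * cs.simple j := by
  induction n with
  | zero => simp
  | succ n ih =>
    rw [pow_succ, ← mul_assoc, ih, ← pow_succ, pow_succ', mul_inv_rev, mul_inv_rev, cs.inv_simple,
      cs.inv_simple]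
    simp only [mul_assoc]

-- The sign changes whenever a successive conjugate of `p.1` meets `s_j` or `s_i`; pulled back to
-- `p.1`, these events are the elements `r^{-n} s_j` with `r = s_i s_j` and `n < 2k`.
open Classical in
theorem signedConj_pow (i j : B) (k : ℕ) (p : W × ZMod 2) :
    ((cs.signedConj i * cs.signedConj j) ^ k : Function.End (W × ZMod 2)) p =
      ((cs.simple i * cs.simple j) ^ k * p.1 * ((cs.simple i * cs.simple j) ^ k)⁻¹,
        p.2 + ∑ n ∈ Finset.range (2 * k),
          if p.1 = ((cs.simple i * cs.simple j) ^ n)⁻¹ * cs.simple j then 1 else 0) := by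
  induction k with
  | zero => simp; rfl
  | succ k ih =>
    have h : ((cs.signedConj i * cs.signedConj j) ^ (k + 1) : Function.End (W × ZMod 2)) p =
        cs.signedConj i (cs.signedConj j
          (((cs.signedConj i * cs.signedConj j) ^ k : Function.End (W × ZMod 2)) p)) := by
      rw [pow_succ']; rfl
    rw [h, ih, mul_add, mul_one, Finset.sum_range_succ, Finset.sum_range_succ]
    set r := cs.simple i * cs.simple j with hr
    have hp : ∀ n, cs.simple j * r ^ n = (r ^ n)⁻¹ * cs.simple j := cs.simple_mul_pow i j
    have h1 : r ^ k * p.1 * (r ^ k)⁻¹ = cs.simple j ↔ p.1 = (r ^ (2 * k))⁻¹ * cs.simple j := by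
      have e1 : (r ^ (2 * k))⁻¹ * cs.simple j = (r ^ k)⁻¹ * cs.simple j * r ^ k := by
        rw [mul_assoc, hp, two_mul, pow_add, mul_inv_rev, mul_assoc]
      rw [e1]
      constructor
      · intro h; rw [← h]; group
      · intro h; rw [h]; group
    have h2 : cs.simple j * (r ^ k * p.1 * (r ^ k)⁻¹) * cs.simple j = cs.simple i ↔
        p.1 = (r ^ (2 * k + 1))⁻¹ * cs.simple j := by
      have e1 : (r ^ (2 * k + 1))⁻¹ * cs.simple j =
          (r ^ k)⁻¹ * (cs.simple j * cs.simple i * cs.simple j) * r ^ k := by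
        have : cs.simple j * cs.simple i = r⁻¹ := by simp [hr]
        rw [mul_assoc, mul_assoc (cs.simple j * cs.simple i), hp, this, two_mul,
          add_assoc, pow_add, pow_succ, mul_inv_rev, mul_inv_rev]
        group
      rw [e1]
      constructor
      · intro h; rw [← h]; simp [mul_assoc]
      · intro h; rw [h]; simp [mul_assoc]
    simp only [signedConj, h1, h2]
    refine Prod.ext ?_ ?_
    · simp [pow_succ', hr, mul_assoc]
    · simp only [add_assoc]

theorem isLiftable_signedConj : C.IsLiftable cs.signedConj := by
  classical
  intro i j
  funext p
  -- With `m = C i j`, the sum over `n < 2m` splits into two halves that agree because `(s_i s_j)^m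
  -- = 1`; they cancel in characteristic two.
  rw [signedConj_pow, cs.simple_mul_simple_pow, two_mul, Finset.sum_range_add]
  simp only [pow_add, cs.simple_mul_simple_pow, one_mul, CharTwo.add_self_eq_zero]
  simp
  rfl

/-- The action of the Coxeter group on signed group elements. -/
noncomputable def signedConjHom : W →* Function.End (W × ZMod 2) :=
  cs.lift ⟨cs.signedConj, cs.isLiftable_signedConj⟩

-- The left side depends only on the group element, so the parity of the multiplicity of any element
-- in the right inversion sequence is the same for all words of that group element.
open Classical in
theorem signedConjHom_wordProd (ω : List B) (p : W × ZMod 2) :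
    cs.signedConjHom (cs.wordProd ω) p =
      (cs.wordProd ω * p.1 * (cs.wordProd ω)⁻¹, p.2 + (cs.rightInvSeq ω).count p.1) := by
  induction ω with
  | nil => simp; rfl
  | cons i ω ih =>
    have h : cs.signedConjHom (cs.wordProd (i :: ω)) p =
        cs.signedConj i (cs.signedConjHom (cs.wordProd ω) p) := by
      rw [wordProd_cons, map_mul]
      change cs.signedConjHom (cs.simple i) _ = _
      rw [signedConjHom, lift_apply_simple]
    have h1 : cs.wordProd ω * p.1 * (cs.wordProd ω)⁻¹ = cs.simple i ↔
        (cs.wordProd ω)⁻¹ * cs.simple i * cs.wordProd ω = p.1 := by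
      constructor
      · intro h; rw [← h]; group
      · intro h; rw [← h]; group
    rw [h, ih]
    simp only [signedConj, h1, rightInvSeq, List.count_cons, wordProd_cons, beq_iff_eq]
    refine Prod.ext ?_ ?_
    · simp [mul_assoc]
    · push_cast; simp only [add_assoc]

/-- Every word of an element with right descent `i` has `s_i` in its right inversion sequence. -/
theorem simple_mem_rightInvSeq {ω : List B} {i : B} (h : cs.IsRightDescent (cs.wordProd ω) i) :
    cs.simple i ∈ cs.rightInvSeq ω := by
  classical
  obtain ⟨ω', hω', hw⟩ := cs.exists_isReduced (cs.wordProd ω * cs.simple i)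
  have hprod : cs.wordProd (ω'.concat i) = cs.wordProd ω := by
    rw [wordProd_concat, ← hw, cs.simple_mul_simple_cancel_right]
  have hred : cs.IsReduced (ω'.concat i) := by
    rw [IsReduced, hprod, List.length_concat, ← hω', ← hw, (cs.isRightDescent_iff).1 h]
  have hmem : cs.simple i ∈ cs.rightInvSeq (ω'.concat i) := by
    rw [rightInvSeq_concat]; simp
  -- In the reduced word `ω' i` the reflection `s_i` occurs exactly once, so its multiplicity for
  -- `ω` is odd.
  have h1 := cs.signedConjHom_wordProd (ω'.concat i) (cs.simple i, 0)
  rw [hprod, cs.signedConjHom_wordProd ω, List.count_eq_one_of_mem hred.nodup_rightInvSeq hmem]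
    at h1
  by_contra hn
  have h2 := congrArg Prod.snd h1
  rw [List.count_eq_zero_of_not_mem hn] at h2
  simp at h2

/-- If left multiplication by `s_j` creates the right descent `i`, then it agrees with right
multiplication by `s_i`. -/
theorem simple_mul_eq_mul_simple {w : W} {i j : B} (h : ¬cs.IsRightDescent w i)
    (h' : cs.IsRightDescent (cs.simple j * w) i) : cs.simple j * w = w * cs.simple i := by
  obtain ⟨ω, hω, rfl⟩ := cs.exists_isReduced w
  rw [← wordProd_cons] at h'
  have hmem := cs.simple_mem_rightInvSeq h'
  rw [rightInvSeq, List.mem_cons] at hmem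
  -- The first entry is `w⁻¹ s_j w`, which gives the claim; any later entry is an inversion of `w`
  -- itself.
  rcases hmem with hmem | hmem
  · rw [hmem]; group
  · exact absurd (cs.isRightInversion_of_mem_rightInvSeq hω hmem).2 h

end Exchange

/-! ### Weak orders in terms of length additivity. -/

section Order

variable {B W : Type*} [Group W] {C : CoxeterMatrix B} (cs : CoxeterSystem C W)

theorem leftLE_iff {u v : W} :
    cs.LeftLE u v ↔ cs.length (v * u⁻¹) + cs.length u = cs.length v := by
  constructor
  · rintro ⟨ω, ω', hω, rfl, hω', rfl, t, rfl⟩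
    have h1 := cs.length_wordProd_le t
    have h2 := cs.length_mul_le (cs.wordProd t) (cs.wordProd ω)
    rw [IsReduced, List.length_append] at hω'
    rw [wordProd_append] at *
    rw [mul_inv_cancel_right]
    rw [IsReduced] at hω
    omega
  · intro h
    obtain ⟨ω, hω, hu⟩ := cs.exists_isReduced u
    obtain ⟨t, ht, hv⟩ := cs.exists_isReduced (v * u⁻¹)
    have hp : cs.wordProd (t ++ ω) = v := by
      rw [wordProd_append, ← hu, ← hv, inv_mul_cancel_right]
    refine ⟨ω, t ++ ω, hω, hu.symm, ?_, hp, List.suffix_append _ _⟩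
    rw [IsReduced, hp, ← h, List.length_append, ← hω.eq, ← ht.eq, ← hu, ← hv]

theorem leftRightLE_iff {u v : W} :
    cs.LeftRightLE u v ↔
      ∃ x y : W, v = x * u * y ∧ cs.length v = cs.length x + cs.length u + cs.length y := by
  constructor
  · rintro ⟨ω, ω', hω, rfl, hω', rfl, s, t, rfl⟩
    refine ⟨cs.wordProd s, cs.wordProd t, by simp only [wordProd_append], ?_⟩
    have h1 := cs.length_wordProd_le s
    have h2 := cs.length_wordProd_le t
    have h3 := cs.length_mul_le (cs.wordProd s * cs.wordProd ω) (cs.wordProd t)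
    have h4 := cs.length_mul_le (cs.wordProd s) (cs.wordProd ω)
    rw [IsReduced] at hω hω'
    rw [hω']
    simp only [wordProd_append, List.length_append] at *
    omega
  · rintro ⟨x, y, rfl, h⟩
    obtain ⟨ω, hω, rfl⟩ := cs.exists_isReduced u
    obtain ⟨s, hs, rfl⟩ := cs.exists_isReduced x
    obtain ⟨t, ht, rfl⟩ := cs.exists_isReduced y
    refine ⟨ω, s ++ ω ++ t, hω, rfl, ?_, by simp only [wordProd_append], ⟨s, t, rfl⟩⟩
    rw [IsReduced] at *
    simp only [wordProd_append, List.length_append]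
    omega

theorem LeftRightLE.antisymm {cs : CoxeterSystem C W} {u v : W} (h : cs.LeftRightLE u v)
    (h' : cs.LeftRightLE v u) : u = v := by
  obtain ⟨x, y, rfl, h1⟩ := cs.leftRightLE_iff.1 h
  obtain ⟨x', y', -, h2⟩ := cs.leftRightLE_iff.1 h'
  have hx : x = 1 := cs.length_eq_zero_iff.1 (by omega)
  have hy : y = 1 := cs.length_eq_zero_iff.1 (by omega)
  simp [hx, hy]

theorem leftLE_refl (u : W) : cs.LeftLE u u := by simp [leftLE_iff]

theorem one_leftLE (u : W) : cs.LeftLE 1 u := by simp [leftLE_iff]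

theorem LeftLE.trans {cs : CoxeterSystem C W} {u v w : W} (h : cs.LeftLE u v)
    (h' : cs.LeftLE v w) : cs.LeftLE u w := by
  rw [leftLE_iff] at *
  have h1 := cs.length_mul_le (w * v⁻¹) (v * u⁻¹)
  have h2 := cs.length_mul_le (w * u⁻¹) u
  simp only [mul_assoc, inv_mul_cancel_left, inv_mul_cancel, mul_one] at h1 h2
  omega

theorem LeftLE.length_mul_inv_add {cs : CoxeterSystem C W} {u v w : W} (h : cs.LeftLE u v)
    (h' : cs.LeftLE v w) :
    cs.length (w * u⁻¹) = cs.length (w * v⁻¹) + cs.length (v * u⁻¹) := by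
  have h'' := h.trans h'
  rw [leftLE_iff] at *
  omega

theorem LeftLE.length_le {cs : CoxeterSystem C W} {u v : W} (h : cs.LeftLE u v) :
    cs.length u ≤ cs.length v := by
  rw [leftLE_iff] at h
  omega

/-- A left descent of `v u⁻¹` can be peeled off `v` without leaving the elements above `u`; this
drives inductions along chains of covers. -/
theorem LeftLE.exists_cover {cs : CoxeterSystem C W} {u v : W} (h : cs.LeftLE u v) (hne : u ≠ v) :
    ∃ j v', v = cs.simple j * v' ∧ cs.LeftLE u v' ∧ cs.length v = cs.length v' + 1 := by
  obtain ⟨j, hj⟩ := cs.exists_leftDescent_of_ne_one (w := v * u⁻¹)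
    (fun h => hne (mul_inv_eq_one.1 h).symm)
  rw [isLeftDescent_iff, ← mul_assoc] at hj
  rw [leftLE_iff] at h
  have h1 := cs.length_mul_le (cs.simple j * v * u⁻¹) u
  rw [inv_mul_cancel_right] at h1
  have h2 := cs.length_simple_mul v j
  refine ⟨j, cs.simple j * v, by simp, ?_, by omega⟩
  rw [leftLE_iff]
  omega

theorem leftLE_simple_mul {j : B} {v : W} (h : cs.length (cs.simple j * v) = cs.length v + 1) :
    cs.LeftLE v (cs.simple j * v) := by
  rw [leftLE_iff, mul_inv_cancel_right, length_simple, h, add_comm]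

end Order

/-! ### The biHecke action on covers and intervals of left order. -/

section Act

variable {B W : Type*} [Group W] {C : CoxeterMatrix B} (cs : CoxeterSystem C W)

theorem act_one (u : W) : cs.act u 1 = u := rfl

theorem biHecke_ext {f g : cs.biHecke} (h : ∀ u, cs.act u f = cs.act u g) : f = g :=
  Subtype.ext (MulOpposite.unop_injective (funext h))

theorem biHecke_induction {p : cs.biHecke → Prop} (one : p 1)
    (antisort : ∀ i, p (cs.antisortGen i)) (sort : ∀ i, p (cs.sortGen i))
    (mul : ∀ f g, p f → p g → p (f * g)) (f : cs.biHecke) : p f := by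
  obtain ⟨f, hf⟩ := f
  induction hf using Submonoid.closure_induction with
  | mem x hx =>
    rcases hx with ⟨i, rfl⟩ | ⟨i, rfl⟩
    · exact antisort i
    · exact sort i
  | one => exact one
  | mul x y hx hy ihx ihy => exact mul _ _ ihx ihy

theorem act_antisortGen_of_isRightDescent {u : W} {i : B} (h : cs.IsRightDescent u i) :
    cs.act u (cs.antisortGen i) = u := if_pos h

theorem act_antisortGen_of_not_isRightDescent {u : W} {i : B} (h : ¬cs.IsRightDescent u i) :
    cs.act u (cs.antisortGen i) = u * cs.simple i := if_neg h

theorem act_sortGen_of_isRightDescent {u : W} {i : B} (h : cs.IsRightDescent u i) :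
    cs.act u (cs.sortGen i) = u * cs.simple i := if_pos h

theorem act_sortGen_of_not_isRightDescent {u : W} {i : B} (h : ¬cs.IsRightDescent u i) :
    cs.act u (cs.sortGen i) = u := if_neg h

/-- If the descent were lost, exchange applied to `s_j u` would give `u s_i = s_j u`, which is
longer than `u`. -/
theorem isRightDescent_simple_mul {u : W} {i j : B}
    (hj : cs.length (cs.simple j * u) = cs.length u + 1) (h : cs.IsRightDescent u i) :
    cs.IsRightDescent (cs.simple j * u) i := by
  by_contra hn
  have := cs.simple_mul_eq_mul_simple (j := j) hn (by simpa using h)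
  rw [cs.simple_mul_simple_cancel_left] at this
  have h2 : u * cs.simple i = cs.simple j * u := by
    rw [this, cs.simple_mul_simple_cancel_right, ← this]
  rw [IsRightDescent, h2] at h
  omega

/-- An element of the biHecke monoid either collapses a cover of left order, or maps it to a cover
with the same label. -/
theorem act_simple_mul (f : cs.biHecke) {j : B} {u : W}
    (hj : cs.length (cs.simple j * u) = cs.length u + 1) :
    cs.act (cs.simple j * u) f = cs.act u f ∨
      cs.act (cs.simple j * u) f = cs.simple j * cs.act u f ∧
        cs.length (cs.simple j * cs.act u f) = cs.length (cs.act u f) + 1 := by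
  induction f using cs.biHecke_induction generalizing u with
  | one => exact Or.inr ⟨rfl, hj⟩
  | antisort i =>
    by_cases h : cs.IsRightDescent u i
    · rw [act_antisortGen_of_isRightDescent _ h,
        act_antisortGen_of_isRightDescent _ (cs.isRightDescent_simple_mul hj h)]
      exact Or.inr ⟨rfl, hj⟩
    · rw [act_antisortGen_of_not_isRightDescent _ h]
      by_cases h' : cs.IsRightDescent (cs.simple j * u) i
      · rw [act_antisortGen_of_isRightDescent _ h']
        exact Or.inl (cs.simple_mul_eq_mul_simple h h')
      · rw [act_antisortGen_of_not_isRightDescent _ h', ← mul_assoc]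
        rw [not_isRightDescent_iff] at h h'
        exact Or.inr ⟨rfl, by omega⟩
  | sort i =>
    by_cases h : cs.IsRightDescent u i
    · have h' := cs.isRightDescent_simple_mul hj h
      rw [act_sortGen_of_isRightDescent _ h, act_sortGen_of_isRightDescent _ h', ← mul_assoc]
      rw [isRightDescent_iff] at h h'
      exact Or.inr ⟨rfl, by omega⟩
    · rw [act_sortGen_of_not_isRightDescent _ h]
      by_cases h' : cs.IsRightDescent (cs.simple j * u) i
      · rw [act_sortGen_of_isRightDescent _ h', cs.simple_mul_eq_mul_simple h h',
          cs.simple_mul_simple_cancel_right]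
        exact Or.inl rfl
      · rw [act_sortGen_of_not_isRightDescent _ h']
        exact Or.inr ⟨rfl, hj⟩
  | mul f g hf hg =>
    rw [act_mul, act_mul]
    rcases hf hj with h | ⟨h, h'⟩
    · rw [h]; exact Or.inl rfl
    · rw [h]; exact hg h'

/-- Elements of the biHecke monoid preserve left order and do not increase differences of lengths;
where such a difference is kept, so is the quotient. -/
theorem LeftLE.act_aux {cs : CoxeterSystem C W} {u v : W} (h : cs.LeftLE u v) (f : cs.biHecke) :
    cs.LeftLE (cs.act u f) (cs.act v f) ∧
      cs.length (cs.act v f) + cs.length u ≤ cs.length v + cs.length (cs.act u f) ∧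
      (cs.length (cs.act v f) + cs.length u = cs.length v + cs.length (cs.act u f) →
        cs.act v f * (cs.act u f)⁻¹ = v * u⁻¹) := by
  induction hn : cs.length v generalizing v with
  | zero =>
    have hv : v = 1 := cs.length_eq_zero_iff.1 hn
    have hu : u = 1 := cs.length_eq_zero_iff.1 (by have := h.length_le; omega)
    subst hu hv
    exact ⟨cs.leftLE_refl _, by omega, by simp⟩
  | succ n ih =>
    by_cases hne : u = v
    · subst hne
      exact ⟨cs.leftLE_refl _, by omega, by simp⟩
    obtain ⟨j, v', rfl, huv, hl⟩ := h.exists_cover hne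
    obtain ⟨h1, h2, h3⟩ := ih huv (by omega)
    -- A collapsed top cover makes the length inequality strict, so the equality case is void; a
    -- kept cover multiplies both quotients by `s_j`.
    rcases cs.act_simple_mul f hl with h | ⟨h, h'⟩
    · rw [h]
      exact ⟨h1, by omega, by omega⟩
    · rw [h]
      refine ⟨h1.trans (cs.leftLE_simple_mul h'), by omega, fun h4 => ?_⟩
      rw [mul_assoc, mul_assoc, h3 (by omega)]

theorem LeftLE.act {cs : CoxeterSystem C W} {u v : W} (h : cs.LeftLE u v) (f : cs.biHecke) :
    cs.LeftLE (cs.act u f) (cs.act v f) := (h.act_aux f).1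

theorem LeftLE.length_act_add_le {cs : CoxeterSystem C W} {u v : W} (h : cs.LeftLE u v)
    (f : cs.biHecke) :
    cs.length (cs.act v f) + cs.length u ≤ cs.length v + cs.length (cs.act u f) :=
  (h.act_aux f).2.1

theorem LeftLE.act_mul_inv_act {cs : CoxeterSystem C W} {u v : W} (h : cs.LeftLE u v)
    (f : cs.biHecke)
    (hl : cs.length (cs.act v f) + cs.length u = cs.length v + cs.length (cs.act u f)) :
    cs.act v f * (cs.act u f)⁻¹ = v * u⁻¹ := (h.act_aux f).2.2 hl

/-- If the difference of the lengths of the ends of an interval is kept, then the interval is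
translated. -/
theorem act_eq_of_mem_leftInterval {a b u : W} (f : cs.biHecke) (hu : u ∈ cs.leftInterval a b)
    (hl : cs.length (cs.act b f) + cs.length a = cs.length b + cs.length (cs.act a f)) :
    cs.act u f = u * a⁻¹ * cs.act a f := by
  have h1 := hu.1.length_act_add_le f
  have h2 := hu.2.length_act_add_le f
  -- The inequalities for `[a, u]` and `[u, b]` add up to the equality `hl`, so both are equalities.
  exact eq_mul_of_mul_inv_eq (hu.1.act_mul_inv_act f (by omega))

theorem act_eq_self_of_mem_leftInterval {a b u : W} (f : cs.biHecke)
    (hu : u ∈ cs.leftInterval a b) (ha : cs.act a f = a) (hb : cs.act b f = b) :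
    cs.act u f = u := by
  rw [cs.act_eq_of_mem_leftInterval f hu (by rw [ha, hb]), ha, inv_mul_cancel_right]

theorem antisortWord_cons (i : B) (ω : List B) :
    cs.antisortWord (i :: ω) = cs.antisortGen i * cs.antisortWord ω := by simp [antisortWord]

theorem sortWord_cons (i : B) (ω : List B) :
    cs.sortWord (i :: ω) = cs.sortGen i * cs.sortWord ω := by simp [sortWord]

/-- Length additivity makes every letter an ascent, so no generator acts trivially. -/
theorem act_antisortWord {v : W} {ω : List B}
    (h : cs.length (v * cs.wordProd ω) = cs.length v + ω.length) :
    cs.act v (cs.antisortWord ω) = v * cs.wordProd ω := by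
  induction ω generalizing v with
  | nil => simp [antisortWord, act_one]
  | cons i ω ih =>
    rw [wordProd_cons, ← mul_assoc, List.length_cons] at h
    have h1 := cs.length_mul_le (v * cs.simple i) (cs.wordProd ω)
    have h2 := cs.length_wordProd_le ω
    have h3 := cs.length_mul_simple v i
    rw [antisortWord_cons, act_mul, act_antisortGen_of_not_isRightDescent, ih (by omega),
      wordProd_cons, mul_assoc]
    rw [not_isRightDescent_iff]
    omega

theorem act_sortWord {v : W} {ω : List B}
    (h : cs.length (v * cs.wordProd ω) + ω.length = cs.length v) :
    cs.act v (cs.sortWord ω) = v * cs.wordProd ω := by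
  induction ω generalizing v with
  | nil => simp [sortWord, act_one]
  | cons i ω ih =>
    rw [wordProd_cons, ← mul_assoc, List.length_cons] at h
    have h1 := cs.length_le_length_mul_add_right (v * cs.simple i) (cs.wordProd ω)
    have h2 := cs.length_wordProd_le ω
    have h3 := cs.length_mul_simple v i
    rw [sortWord_cons, act_mul, act_sortGen_of_isRightDescent, ih (by omega),
      wordProd_cons, mul_assoc]
    rw [isRightDescent_iff]
    omega

theorem act_antisort {v p : W} (h : cs.length (v * p) = cs.length v + cs.length p) :
    cs.act v (cs.antisort p) = v * p := by
  obtain ⟨h1, h2⟩ := cs.reducedWord_spec p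
  have := cs.act_antisortWord (v := v) (ω := cs.reducedWord p) (by rw [← h1, ← h2, h])
  rwa [← h2] at this

theorem act_sort {v p : W} (h : cs.length (v * p) + cs.length p = cs.length v) :
    cs.act v (cs.sort p) = v * p := by
  obtain ⟨h1, h2⟩ := cs.reducedWord_spec p
  have := cs.act_sortWord (v := v) (ω := cs.reducedWord p) (by rw [← h1, ← h2, h])
  rwa [← h2] at this

theorem act_one_antisort (p : W) : cs.act 1 (cs.antisort p) = p := by
  simpa using cs.act_antisort (v := 1) (p := p) (by simp)

theorem act_sort_inv {a v : W} (h : cs.LeftLE a v) : cs.act v (cs.sort a⁻¹) = v * a⁻¹ :=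
  cs.act_sort (by rw [length_inv, cs.leftLE_iff.1 h])

/-- The translation between two intervals with the same type. -/
theorem act_sort_inv_mul_antisort {a b c d u : W} (hu : u ∈ cs.leftInterval a b)
    (hcd : cs.LeftLE c d) (h : d * c⁻¹ = b * a⁻¹) :
    cs.act u (cs.sort a⁻¹ * cs.antisort c) = u * a⁻¹ * c ∧
      u * a⁻¹ * c ∈ cs.leftInterval c d := by
  have hab := hu.1.trans hu.2
  -- Sorting by `a⁻¹` slides `[a, b]` down to `[1, b a⁻¹]`, and antisorting by `c` lifts that to
  -- `[c, d]`. Only the two ends need computing; the length difference is kept, so the rest follows.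
  have ha : cs.act a (cs.sort a⁻¹ * cs.antisort c) = c := by
    rw [act_mul, cs.act_sort_inv (cs.leftLE_refl a), mul_inv_cancel, act_one_antisort]
  have hd := cs.leftLE_iff.1 hcd
  have hb' := cs.leftLE_iff.1 hab
  have hdc : d = b * a⁻¹ * c := by rw [← h, inv_mul_cancel_right]
  have hb : cs.act b (cs.sort a⁻¹ * cs.antisort c) = d := by
    rw [act_mul, cs.act_sort_inv hab, hdc, act_antisort]
    rw [← hdc, ← h, hd]
  have hact := cs.act_eq_of_mem_leftInterval (cs.sort a⁻¹ * cs.antisort c) hu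
    (by rw [ha, hb]; rw [h] at hd; omega)
  rw [ha] at hact
  refine ⟨hact, ?_, ?_⟩
  · have := hu.1.act (cs.sort a⁻¹ * cs.antisort c)
    rwa [hact, ha] at this
  · have := hu.2.act (cs.sort a⁻¹ * cs.antisort c)
    rwa [hact, hb] at this

end Act

/-! ### Independence of the reduced word. -/

section WellDefined

variable {B W : Type*} [Group W] {C : CoxeterMatrix B} (cs : CoxeterSystem C W)

open Classical in
/-- The elementary antisorting map on the left: it fixes `w` if `j` is a left descent of `w`, and
sends `w` to `s_j w` otherwise. -/
noncomputable def leftAntisortFun (j : B) (w : W) : W :=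
  if cs.IsLeftDescent w j then w else cs.simple j * w

theorem leftAntisortFun_act_antisortGen (i j : B) (w : W) :
    cs.act (cs.leftAntisortFun j w) (cs.antisortGen i) =
      cs.leftAntisortFun j (cs.act w (cs.antisortGen i)) := by
  by_cases hj : cs.IsLeftDescent w j
  · rw [leftAntisortFun, if_pos hj]
    by_cases hi : cs.IsRightDescent w i
    · rw [act_antisortGen_of_isRightDescent _ hi, leftAntisortFun, if_pos hj]
    · rw [act_antisortGen_of_not_isRightDescent _ hi, leftAntisortFun, if_pos]
      rw [not_isRightDescent_iff] at hi
      rw [IsLeftDescent] at *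
      have := cs.length_mul_le (cs.simple j * w) (cs.simple i)
      rw [length_simple, mul_assoc] at this
      omega
  · rw [leftAntisortFun, if_neg hj]
    rw [not_isLeftDescent_iff] at hj
    rcases cs.act_simple_mul (cs.antisortGen i) hj with h | ⟨h, h'⟩
    -- On a collapse, the common image is also the image of `s_j w`, which still has left descent
    -- `j`.
    · rw [h, leftAntisortFun, if_pos]
      rw [← h]
      by_cases hi : cs.IsRightDescent (cs.simple j * w) i
      · rw [act_antisortGen_of_isRightDescent _ hi, IsLeftDescent,
          cs.simple_mul_simple_cancel_left]
        omega
      · rw [act_antisortGen_of_not_isRightDescent _ hi, IsLeftDescent, mul_assoc,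
          cs.simple_mul_simple_cancel_left, ← mul_assoc]
        rw [not_isRightDescent_iff] at hi
        have := cs.length_mul_le w (cs.simple i)
        rw [length_simple] at this
        omega
    · rw [h, leftAntisortFun, if_neg]
      rw [not_isLeftDescent_iff]
      exact h'

theorem leftAntisortFun_act_antisortWord (ω : List B) (j : B) (w : W) :
    cs.act (cs.leftAntisortFun j w) (cs.antisortWord ω) =
      cs.leftAntisortFun j (cs.act w (cs.antisortWord ω)) := by
  induction ω generalizing w with
  | nil => rfl
  | cons i ω ih => rw [antisortWord_cons, act_mul, act_mul, leftAntisortFun_act_antisortGen, ih]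

/-- Left antisorting commutes with the action of `antisortWord` and reaches every element from `1`,
so the value at `1` determines the map. -/
theorem antisortWord_eq_of_act_one {ω ω' : List B}
    (h : cs.act 1 (cs.antisortWord ω) = cs.act 1 (cs.antisortWord ω')) :
    cs.antisortWord ω = cs.antisortWord ω' := by
  refine cs.biHecke_ext fun u => ?_
  induction hn : cs.length u generalizing u with
  | zero => rwa [cs.length_eq_zero_iff.1 hn]
  | succ n ih =>
    have hne : u ≠ 1 := by rintro rfl; simp at hn
    obtain ⟨j, u', rfl, -, hl⟩ := (cs.one_leftLE u).exists_cover hne.symm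
    have hj : cs.simple j * u' = cs.leftAntisortFun j u' := by
      rw [leftAntisortFun, if_neg]
      rw [not_isLeftDescent_iff, hl]
    rw [hj, leftAntisortFun_act_antisortWord, leftAntisortFun_act_antisortWord, ih u' (by omega)]

theorem antisortWord_eq {ω ω' : List B} (hω : cs.IsReduced ω) (hω' : cs.IsReduced ω')
    (h : cs.wordProd ω = cs.wordProd ω') : cs.antisortWord ω = cs.antisortWord ω' := by
  apply antisortWord_eq_of_act_one
  rw [act_antisortWord, act_antisortWord, h] <;> simp only [one_mul, length_one, zero_add]
  exacts [hω', hω]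

theorem antisort_wordProd {ω : List B} (hω : cs.IsReduced ω) :
    cs.antisort (cs.wordProd ω) = cs.antisortWord ω :=
  cs.antisortWord_eq (cs.reducedWord_spec _).1 hω (cs.reducedWord_spec _).2.symm

end WellDefined

/-! ### The longest element and the duality of sorting and antisorting. -/

section Longest

variable {B W : Type*} [Group W] [Finite W] {C : CoxeterMatrix B} (cs : CoxeterSystem C W)

theorem isRightDescent_longest (i : B) : cs.IsRightDescent cs.longest i := by
  by_contra h
  rw [not_isRightDescent_iff] at h
  have := cs.length_le_length_longest (cs.longest * cs.simple i)
  omega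

theorem act_longest_antisortWord (ω : List B) :
    cs.act cs.longest (cs.antisortWord ω) = cs.longest := by
  induction ω with
  | nil => rfl
  | cons i ω ih =>
    rw [antisortWord_cons, act_mul,
      act_antisortGen_of_isRightDescent _ (cs.isRightDescent_longest i), ih]

/-- `π_u` preserves left order, sends `1` to `u` and fixes `w₀`, so it carries `1 ≤ w₀` to the
claim. -/
theorem leftLE_longest (u : W) : cs.LeftLE u cs.longest := by
  have := (cs.one_leftLE cs.longest).act (cs.antisort u)
  rwa [act_one_antisort, antisort, act_longest_antisortWord] at this

theorem length_longest_mul_inv_add (u : W) :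
    cs.length (cs.longest * u⁻¹) + cs.length u = cs.length cs.longest :=
  cs.leftLE_iff.1 (cs.leftLE_longest u)

theorem longest_mul_self : cs.longest * cs.longest = 1 := by
  -- At `u = w₀⁻¹` the formula forces `ℓ(w₀ w₀) = 0`.
  have := cs.length_longest_mul_inv_add cs.longest⁻¹
  rw [length_inv, inv_inv] at this
  exact cs.length_eq_zero_iff.1 (by omega)

theorem longest_inv : cs.longest⁻¹ = cs.longest :=
  inv_eq_of_mul_eq_one_left cs.longest_mul_self

theorem length_add_length_inv_mul_longest (w : W) :
    cs.length w + cs.length (w⁻¹ * cs.longest) = cs.length cs.longest := by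
  simpa using cs.length_longest_mul_inv_add (w⁻¹ * cs.longest)

theorem length_longest_mul_add (w : W) :
    cs.length (cs.longest * w) + cs.length w = cs.length cs.longest := by
  simpa using cs.length_longest_mul_inv_add w⁻¹

theorem isRightDescent_longest_mul_iff {w : W} {i : B} :
    cs.IsRightDescent (cs.longest * w) i ↔ ¬cs.IsRightDescent w i := by
  have h1 := cs.length_longest_mul_add w
  have h2 := cs.length_longest_mul_add (w * cs.simple i)
  have h3 := cs.length_mul_simple_ne w i
  rw [IsRightDescent, IsRightDescent, mul_assoc]
  omega

/-- Left multiplication by `w₀` complements right descents and so exchanges the two kinds of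
generators; statements on `antisortWord` thereby transfer to `sortWord`. -/
theorem act_sortGen_eq (i : B) (w : W) :
    cs.act w (cs.sortGen i) = cs.longest * cs.act (cs.longest * w) (cs.antisortGen i) := by
  by_cases h : cs.IsRightDescent w i
  · rw [act_sortGen_of_isRightDescent _ h, act_antisortGen_of_not_isRightDescent, ← mul_assoc,
      ← mul_assoc, longest_mul_self, one_mul]
    rwa [isRightDescent_longest_mul_iff, not_not]
  · rw [act_sortGen_of_not_isRightDescent _ h, act_antisortGen_of_isRightDescent, ← mul_assoc,
      longest_mul_self, one_mul]
    rwa [isRightDescent_longest_mul_iff]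

theorem act_sortWord_eq (ω : List B) (w : W) :
    cs.act w (cs.sortWord ω) = cs.longest * cs.act (cs.longest * w) (cs.antisortWord ω) := by
  induction ω generalizing w with
  | nil => simp [sortWord, antisortWord, act_one, ← mul_assoc, longest_mul_self]
  | cons i ω ih =>
    rw [sortWord_cons, antisortWord_cons, act_mul, act_mul, ih, act_sortGen_eq, ← mul_assoc,
      longest_mul_self, one_mul]

theorem sort_wordProd {ω : List B} (hω : cs.IsReduced ω) :
    cs.sort (cs.wordProd ω) = cs.sortWord ω := by
  refine cs.biHecke_ext fun u => ?_
  rw [sort, act_sortWord_eq, act_sortWord_eq,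
    cs.antisortWord_eq (cs.reducedWord_spec _).1 hω (cs.reducedWord_spec _).2.symm]

end Longest

/-! ### Images of idempotents, and the idempotents `e_w`. -/

section Idempotent

variable {B W : Type*} [Group W] {C : CoxeterMatrix B} (cs : CoxeterSystem C W)

theorem act_mem_imageSet (u : W) (f : cs.biHecke) : cs.act u f ∈ cs.imageSet f := ⟨u, rfl⟩

theorem isIdempotentElem_iff {e : cs.biHecke} :
    IsIdempotentElem e ↔ ∀ u ∈ cs.imageSet e, cs.act u e = u := by
  constructor
  · rintro h _ ⟨u, rfl⟩
    change cs.act (cs.act u e) e = _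
    rw [← act_mul, h.eq]
  · exact fun h => cs.biHecke_ext fun u => h _ (cs.act_mem_imageSet u e)

variable [Finite W]

theorem imageSet_subset (e : cs.biHecke) :
    cs.imageSet e ⊆ cs.leftInterval (cs.act 1 e) (cs.act cs.longest e) := by
  rintro _ ⟨u, rfl⟩
  exact ⟨(cs.one_leftLE u).act e, (cs.leftLE_longest u).act e⟩

theorem imageSet_eq_of_isIdempotentElem {e : cs.biHecke} (he : IsIdempotentElem e) :
    cs.imageSet e = cs.leftInterval (cs.act 1 e) (cs.act cs.longest e) := by
  refine (cs.imageSet_subset e).antisymm fun u hu => ⟨u, ?_⟩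
  rw [isIdempotentElem_iff] at he
  exact cs.act_eq_self_of_mem_leftInterval e hu (he _ (cs.act_mem_imageSet _ _))
    (he _ (cs.act_mem_imageSet _ _))

theorem act_one_idem (w : W) : cs.act 1 (cs.idem w) = 1 := by
  -- The two indices in `e_w` are mutually inverse: `1` is lifted to `w⁻¹ w₀` and then sorted back.
  have : cs.longest * w = (w⁻¹ * cs.longest)⁻¹ := by simp [longest_inv]
  rw [idem, act_mul, act_one_antisort, this, cs.act_sort_inv (cs.leftLE_refl _), mul_inv_cancel]

theorem act_longest_idem (w : W) : cs.act cs.longest (cs.idem w) = w := by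
  have : cs.longest * w = (w⁻¹ * cs.longest)⁻¹ := by simp [longest_inv]
  rw [idem, act_mul, antisort, act_longest_antisortWord, this,
    cs.act_sort_inv (cs.leftLE_longest _), ← this, ← mul_assoc, longest_mul_self, one_mul]

/-- The first factor of `e_w` lifts `w` to `w₀`, which it also fixes; so `w` and `w₀` have the same
image. -/
theorem act_self_idem (w : W) : cs.act w (cs.idem w) = w := by
  have h : cs.act w (cs.antisort (w⁻¹ * cs.longest)) = cs.longest := by
    rw [act_antisort, mul_inv_cancel_left]
    rw [mul_inv_cancel_left, length_add_length_inv_mul_longest]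
  have h' := cs.act_longest_idem w
  rw [idem, act_mul, antisort, act_longest_antisortWord] at h'
  rw [idem, act_mul, h, h']

theorem isIdempotentElem_idem (w : W) : IsIdempotentElem (cs.idem w) := by
  rw [isIdempotentElem_iff]
  intro u hu
  have h := cs.imageSet_subset _ hu
  rw [act_one_idem, act_longest_idem] at h
  exact cs.act_eq_self_of_mem_leftInterval _ h (cs.act_one_idem w) (cs.act_self_idem w)

theorem imageSet_idem (w : W) : cs.imageSet (cs.idem w) = cs.leftInterval 1 w := by
  rw [imageSet_eq_of_isIdempotentElem _ (cs.isIdempotentElem_idem w), act_one_idem,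
    act_longest_idem]

end Idempotent

/-! ### Two-sided ideals, conjugacy and types of intervals. -/

section Conjugacy

theorem mem_twoSidedIdeal_trans {M : Type*} [Monoid M] {e f g : M} (h : f ∈ twoSidedIdeal e)
    (h' : g ∈ twoSidedIdeal f) : g ∈ twoSidedIdeal e := by
  obtain ⟨x, y, rfl⟩ := h
  obtain ⟨z, t, rfl⟩ := h'
  exact ⟨z * x, y * t, by simp only [mul_assoc]⟩

theorem jEquiv_iff {M : Type*} [Monoid M] {e f : M} :
    JEquiv e f ↔ e ∈ twoSidedIdeal f ∧ f ∈ twoSidedIdeal e := by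
  constructor
  · intro h
    rw [JEquiv] at h
    exact ⟨h ▸ ⟨1, 1, by simp⟩, h ▸ ⟨1, 1, by simp⟩⟩
  · rintro ⟨h, h'⟩
    ext g
    exact ⟨mem_twoSidedIdeal_trans h, mem_twoSidedIdeal_trans h'⟩

theorem ConjugateIdem.jEquiv {M : Type*} [Monoid M] {e f : M} (he : IsIdempotentElem e)
    (hf : IsIdempotentElem f) (h : ConjugateIdem e f) : JEquiv e f := by
  obtain ⟨x, y, rfl, rfl⟩ := h
  refine jEquiv_iff.2 ⟨⟨x, y, ?_⟩, ⟨y, x, ?_⟩⟩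
  -- `e = e e = x (y x) y = x f y`.
  · nth_rw 1 [← he.eq]; simp only [mul_assoc]
  · nth_rw 1 [← hf.eq]; simp only [mul_assoc]

variable {B W : Type*} [Group W] {C : CoxeterMatrix B} (cs : CoxeterSystem C W)

theorem leftLE_of_imageSet_eq {e : cs.biHecke} {a b : W}
    (h : cs.imageSet e = cs.leftInterval a b) : cs.LeftLE a b := by
  have : cs.act 1 e ∈ cs.leftInterval a b := h ▸ cs.act_mem_imageSet 1 e
  exact this.1.trans this.2

/-- Two idempotents whose images are intervals of the same type are conjugate. -/
theorem conjugateIdem_of_type_eq {e f : cs.biHecke} (he : IsIdempotentElem e)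
    (hf : IsIdempotentElem f) {a b c d : W} (hab : cs.imageSet e = cs.leftInterval a b)
    (hcd : cs.imageSet f = cs.leftInterval c d) (h : d * c⁻¹ = b * a⁻¹) :
    ConjugateIdem e f := by
  -- The witnesses are the two translations, flanked by `e` and `f`, which act as identities on
  -- their own images. The claim is symmetric, so one product suffices.
  have key : ∀ {e f : cs.biHecke}, IsIdempotentElem e → IsIdempotentElem f → ∀ {a b c d : W},
      cs.imageSet e = cs.leftInterval a b → cs.imageSet f = cs.leftInterval c d →
      d * c⁻¹ = b * a⁻¹ →
      e = e * (cs.sort a⁻¹ * cs.antisort c) * f * (f * (cs.sort c⁻¹ * cs.antisort a) * e) := by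
    intro e f he hf a b c d hab hcd h
    refine cs.biHecke_ext fun u => ?_
    have hu : cs.act u e ∈ cs.leftInterval a b := hab ▸ cs.act_mem_imageSet u e
    obtain ⟨h1, h2⟩ :=
      cs.act_sort_inv_mul_antisort hu (cs.leftLE_of_imageSet_eq hcd) h
    obtain ⟨h3, -⟩ :=
      cs.act_sort_inv_mul_antisort h2 (cs.leftLE_of_imageSet_eq hab) h.symm
    rw [isIdempotentElem_iff] at he hf
    rw [← hcd] at h2
    change _ = cs.act (cs.act (cs.act (cs.act (cs.act (cs.act u e)
      (cs.sort a⁻¹ * cs.antisort c)) f) f) (cs.sort c⁻¹ * cs.antisort a)) e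
    rw [h1, hf _ h2, hf _ h2, h3]
    simp [he _ (cs.act_mem_imageSet u e)]
  exact ⟨_, _, key he hf hab hcd h, key hf he hcd hab h.symm⟩

/-- The type of the image interval decides the two-sided order on idempotents. -/
theorem mem_twoSidedIdeal_iff {e f : cs.biHecke} (he : IsIdempotentElem e)
    (hf : IsIdempotentElem f) {a b c d : W} (hab : cs.imageSet e = cs.leftInterval a b)
    (hcd : cs.imageSet f = cs.leftInterval c d) :
    f ∈ twoSidedIdeal e ↔ cs.LeftRightLE (d * c⁻¹) (b * a⁻¹) := by
  have hab' := cs.leftLE_of_imageSet_eq hab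
  have hcd' := cs.leftLE_of_imageSet_eq hcd
  rw [isIdempotentElem_iff] at he hf
  constructor
  · rintro ⟨x, y, rfl⟩
    have hc := hf c (hcd ▸ ⟨cs.leftLE_refl c, hcd'⟩)
    have hd := hf d (hcd ▸ ⟨hcd', cs.leftLE_refl d⟩)
    rw [act_mul] at hc hd
    set p := cs.act c (x * e) with hp
    set q := cs.act d (x * e) with hq
    have hpm : p ∈ cs.leftInterval a b := by
      rw [hp, act_mul, ← hab]; exact cs.act_mem_imageSet _ _
    have hqm : q ∈ cs.leftInterval a b := by
      rw [hq, act_mul, ← hab]; exact cs.act_mem_imageSet _ _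
    have hpq : cs.LeftLE p q := hcd'.act (x * e)
    have h1 := hcd'.length_act_add_le (x * e)
    have h2 := hpq.length_act_add_le y
    rw [hc, hd] at h2
    rw [← hp, ← hq] at h1
    -- Since `x e y` fixes `c` and `d`, neither `x e` nor `y` can shrink the length difference; so
    -- `[p, q]` lies in `[a, b]` and has the type of `[c, d]`.
    have h3 : q * p⁻¹ = d * c⁻¹ := hcd'.act_mul_inv_act (x * e) (by rw [← hp, ← hq]; omega)
    rw [leftRightLE_iff, ← h3]
    refine ⟨b * q⁻¹, p * a⁻¹, by group, ?_⟩
    rw [hpm.1.length_mul_inv_add hpm.2, hpq.length_mul_inv_add hqm.2]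
  · rw [leftRightLE_iff]
    rintro ⟨x, y, h, hl⟩
    have hb : b = x * (d * c⁻¹) * y * a := by rw [← h, inv_mul_cancel_right]
    have hba := cs.leftLE_iff.1 hab'
    have l1 := cs.length_mul_le x (d * c⁻¹ * (y * a))
    have l2 := cs.length_mul_le (d * c⁻¹) (y * a)
    have l3 := cs.length_mul_le y a
    have hb' : x * (d * c⁻¹ * (y * a)) = b := by rw [hb]; simp only [mul_assoc]
    rw [hb'] at l1
    -- Additivity in `hl` forces all the subadditivity bounds to be equalities, giving a chain `a ≤
    -- y a ≤ (d c⁻¹) y a ≤ b` whose middle interval has the type of `[c, d]`.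
    have m1 : cs.LeftLE a (y * a) := by
      rw [leftLE_iff, mul_inv_cancel_right]; omega
    have m2 : cs.LeftLE (y * a) (d * c⁻¹ * (y * a)) := by
      rw [leftLE_iff, mul_inv_cancel_right]; omega
    have m3 : cs.LeftLE (d * c⁻¹ * (y * a)) b := by
      rw [leftLE_iff, ← hb', mul_inv_cancel_right, hb']; omega
    -- After `f`, translate `[c, d]` into `[a, b]`, where `e` acts as the identity, and translate
    -- back.
    refine ⟨f * (cs.sort c⁻¹ * cs.antisort (y * a)),
      cs.sort (y * a)⁻¹ * cs.antisort c, ?_⟩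
    refine cs.biHecke_ext fun u => ?_
    have hu : cs.act u f ∈ cs.leftInterval c d := hcd ▸ cs.act_mem_imageSet u f
    obtain ⟨h1, h2⟩ := cs.act_sort_inv_mul_antisort hu m2 (by rw [mul_inv_cancel_right])
    obtain ⟨h3, -⟩ := cs.act_sort_inv_mul_antisort h2 hcd' (by rw [mul_inv_cancel_right])
    have h4 := he (cs.act u f * c⁻¹ * (y * a))
      (by rw [hab]; exact ⟨m1.trans h2.1, h2.2.trans m3⟩)
    rw [act_mul cs u, act_mul cs u, act_mul cs u, h1, h4, h3]
    group

theorem conjugateIdem_iff_type_eq {e f : cs.biHecke} (he : IsIdempotentElem e)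
    (hf : IsIdempotentElem f) {a b c d : W} (hab : cs.imageSet e = cs.leftInterval a b)
    (hcd : cs.imageSet f = cs.leftInterval c d) :
    ConjugateIdem e f ↔ d * c⁻¹ = b * a⁻¹ := by
  refine ⟨fun h => ?_, cs.conjugateIdem_of_type_eq he hf hab hcd⟩
  obtain ⟨h1, h2⟩ := jEquiv_iff.1 (h.jEquiv he hf)
  exact ((cs.mem_twoSidedIdeal_iff he hf hab hcd).1 h2).antisymm
    ((cs.mem_twoSidedIdeal_iff hf he hcd hab).1 h1)

end Conjugacy

end CoxeterSystem

theorem mainTheorem4 {B W : Type*} [Group W] [Finite W] {C : CoxeterMatrix B}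
    (cs : CoxeterSystem C W) :
    -- `π_w` and `π̄_w` can be computed along any reduced word of `w`
    (∀ ω : List B, cs.IsReduced ω →
      cs.antisort (cs.wordProd ω) = cs.antisortWord ω ∧
      cs.sort (cs.wordProd ω) = cs.sortWord ω) ∧
    -- the `e_w` are idempotents, and every idempotent is conjugate to exactly one of them
    (∀ w : W, IsIdempotentElem (cs.idem w)) ∧
    (∀ f : cs.biHecke, IsIdempotentElem f →
      ∃! w : W, CoxeterSystem.ConjugateIdem (cs.idem w) f) ∧
    -- on idempotents, conjugacy is `J`-equivalence
    (∀ e f : cs.biHecke, IsIdempotentElem e → IsIdempotentElem f →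
      (CoxeterSystem.ConjugateIdem e f ↔ CoxeterSystem.JEquiv e f)) ∧
    -- the image sets of idempotents are nonempty intervals in left order
    (∀ e : cs.biHecke, IsIdempotentElem e →
      ∃ a b : W, cs.LeftLE a b ∧ cs.imageSet e = cs.leftInterval a b) ∧
    -- the types of these intervals decide the `J`-order and conjugacy
    (∀ e f : cs.biHecke, IsIdempotentElem e → IsIdempotentElem f →
      ∀ a b c d : W, cs.imageSet e = cs.leftInterval a b → cs.imageSet f = cs.leftInterval c d →
        (f ∈ CoxeterSystem.twoSidedIdeal e ↔ cs.LeftRightLE (d * c⁻¹) (b * a⁻¹)) ∧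
        (CoxeterSystem.ConjugateIdem e f ↔ d * c⁻¹ = b * a⁻¹)) := by
  refine ⟨fun ω hω => ⟨cs.antisort_wordProd hω, cs.sort_wordProd hω⟩, cs.isIdempotentElem_idem,
    fun f hf => ?_, fun e f he hf => ⟨fun h => h.jEquiv he hf, fun h => ?_⟩, fun e he => ?_,
    fun e f he hf a b c d hab hcd => ⟨cs.mem_twoSidedIdeal_iff he hf hab hcd,
      cs.conjugateIdem_iff_type_eq he hf hab hcd⟩⟩
  -- Since `e_w` has type `w`, the only candidate for `w` is the type of the image of `f`.
  · have key := fun w => cs.conjugateIdem_iff_type_eq (cs.isIdempotentElem_idem w) hf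
      (cs.imageSet_idem w) (cs.imageSet_eq_of_isIdempotentElem hf)
    simp only [inv_one, mul_one] at key
    exact ⟨_, (key _).2 rfl, fun w hw => ((key w).1 hw).symm⟩
  · have hE := cs.imageSet_eq_of_isIdempotentElem he
    have hF := cs.imageSet_eq_of_isIdempotentElem hf
    obtain ⟨h1, h2⟩ := CoxeterSystem.jEquiv_iff.1 h
    exact (cs.conjugateIdem_iff_type_eq he hf hE hF).2
      (((cs.mem_twoSidedIdeal_iff he hf hE hF).1 h2).antisymm
        ((cs.mem_twoSidedIdeal_iff hf he hF hE).1 h1))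
  · have hE := cs.imageSet_eq_of_isIdempotentElem he
    exact ⟨_, _, cs.leftLE_of_imageSet_eq hE, hE⟩
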